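/- Let $d\ge 1$ and consider the discrete-time frog model on $\mathbb Z^d$: the numbers of particles $\eta(x)\in\{0,1,2,\dots\}$, $x\in\mathbb Z^d$, initially present at the sites are i.i.d., and $\nu$ denotes the law of $\eta=(\eta(x))_{x\in\mathbb Z^d}$. Given $\eta=\omega$, the particles are assigned independent discrete-time simple random walks $(S^x_{n,k})_{n\ge 0}$, $x\in\mathbb Z^d$, $1\le k\le\omega(x)$, with $S^x_{0,k}=x$; let $\mathbf P_\omega$ be their joint law. Put $$t(x,z)=\min\{n\ge 0: S^x_{n,k}=z\text{ for some }1\le k\le\omega(x)\}$$ ($=\infty$ if there is no such $n$), and $$T(x,z)=\inf\Big\{\sum_{i=1}^m t(x_{i-1},x_i)\Big\},$$ the infimum being over all $m\ge 1$ and all finite sequences $x=x_0,x_1,\dots,x_m=z$ in $\mathbb Z^d$. Let $\xi_n=\{y\in\mathbb Z^d: T(0,y)\le n\}$ be the set of sites visited by active particles up to time $n$ when initially only the particles at $0$ are active, and let $\bar\xi_n=\bigcup_{y\in\xi_n}\big(y+(-1/2,1/2]^d\big)\subset\mathbb R^d$. Suppose that for some $0<\delta<d$ and all sufficiently large $n$,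 $$\mathbf P[\eta(x)\ge n]\ge(\log n)^{-\delta}.$$ Then the shape theorem holds with limiting shape the full diamond $\mathfrak D=\{x\in\mathbb R^d:\|x\|_1\le 1\}$, where $\|x\|_1=|x^{(1)}|+\dots+|x^{(d)}|$. That is, $\mathfrak D$ is nonempty and convex, and for $\nu$-almost every initial configuration $\omega$, conditioned on $\{\eta(0)\ge 1\}$, for every $0<\varepsilon<1$, $\mathbf P_\omega$-almost surely, $$(1-\varepsilon)\mathfrak D\subset\frac{\bar\xi_n}{n}\subset(1+\varepsilon)\mathfrak D\quad\text{for all sufficiently large }n.$$ -/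

import Mathlib

open MeasureTheory Filter
open scoped Pointwise

noncomputable section

namespace FrogModel

/-- The sites of the lattice `ℤ^d`. -/
abbrev Site (d : ℕ) : Type := Fin d → ℤ

/-- An initial configuration: the number of particles at each site. -/
abbrev Config (d : ℕ) : Type := Site d → ℕ

/-- The product measure `ν` on configurations under which the counts `η(x)` are i.i.d. with
law `q`. -/
def configLaw (d : ℕ) (q : Measure ℕ) [IsProbabilityMeasure q] : Measure (Config d) :=
  Measure.infinitePi (fun _ : Site d => q)

/-- The particles of the configuration `ω`: particle `⟨x, k⟩` is the `k`-th of the `ω x` particles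
placed at `x`. -/
abbrev Particle {d : ℕ} (ω : Config d) : Type := Σ x : Site d, Fin (ω x)

/-- The `2d` directions of a nearest-neighbour step. -/
abbrev Dir (d : ℕ) : Type := Fin d × Bool

/-- The unit vector `± e_i` of a direction. -/
def Dir.vec {d : ℕ} (s : Dir d) : Site d := Pi.single s.1 (if s.2 then 1 else -1)

/-- The uniform law on the `2d` directions. -/
def stepLaw (d : ℕ) : Measure (Dir d) := ProbabilityTheory.uniformOn Set.univ

instance (d : ℕ) [NeZero d] : IsProbabilityMeasure (stepLaw d) :=
  ProbabilityTheory.isProbabilityMeasure_uniformOn Set.finite_univ Set.univ_nonempty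

/-- The space of trajectories of all particles of `ω`. A trajectory is recorded by its steps:
`s p i` is the direction of the `(i+1)`-st step of particle `p`. -/
abbrev PathSpace {d : ℕ} (ω : Config d) : Type := Particle ω → ℕ → Dir d

/-- The quenched law `P_ω`: the particles of `ω` have independent walks, each with i.i.d. uniform
steps. -/
def quenchedLaw {d : ℕ} [NeZero d] (ω : Config d) : Measure (PathSpace ω) :=
  Measure.infinitePi (fun _ : Particle ω => Measure.infinitePi (fun _ : ℕ => stepLaw d))

/-- The position `S^x_{n,k}` of particle `p = ⟨x, k⟩` after `n` steps of its own walk. -/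
def walk {d : ℕ} {ω : Config d} (s : PathSpace ω) (p : Particle ω) (n : ℕ) : Site d :=
  p.1 + ∑ i ∈ Finset.range n, (s p i).vec

/-- `t(x,z)`: the least `n` such that some particle of `x` is at `z` after `n` steps (`⊤` if there
is none). -/
def hitTime {d : ℕ} {ω : Config d} (s : PathSpace ω) (x z : Site d) : ℕ∞ :=
  ⨅ (n : ℕ) (_ : ∃ k : Fin (ω x), walk s ⟨x, k⟩ n = z), (n : ℕ∞)

/-- `T(x,z)`: the infimum of `∑ t(x_{i-1}, x_i)` over finite sequences
`x = x_0, x_1, …, x_m = z`, `m ≥ 1`. -/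
def passageTime {d : ℕ} {ω : Config d} (s : PathSpace ω) (x z : Site d) : ℕ∞ :=
  ⨅ (m : ℕ) (u : ℕ → Site d) (_ : 1 ≤ m ∧ u 0 = x ∧ u m = z),
    ∑ i ∈ Finset.range m, hitTime s (u i) (u (i + 1))

/-- `ξ_n^x`: the sites visited up to time `n` by active particles, when initially the active
particles are those at `x`. -/
def visited {d : ℕ} {ω : Config d} (s : PathSpace ω) (x : Site d) (n : ℕ) : Set (Site d) :=
  {y | passageTime s x y ≤ n}

/-- The union of the cubes `y + (-1/2, 1/2]^d` over `y ∈ A`. -/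
def cubes {d : ℕ} (A : Set (Site d)) : Set (Fin d → ℝ) :=
  {v | ∃ y ∈ A, ∀ i, v i - (y i : ℝ) ∈ Set.Ioc (-1 / 2 : ℝ) (1 / 2)}

/-- The shape theorem with limiting shape `A`, for i.i.d. initial counts with law `q`: the set `A`
is nonempty and convex, and for almost every initial configuration `ω` conditioned on
`{η(0) ≥ 1}`, for every `0 < ε < 1`, `P_ω`-almost surely
`(1 - ε) A ⊆ n⁻¹ ξ̄_n ⊆ (1 + ε) A` for all large `n`. -/
def ShapeTheorem (d : ℕ) [NeZero d] (q : Measure ℕ) [IsProbabilityMeasure q]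
    (A : Set (Fin d → ℝ)) : Prop :=
  A.Nonempty ∧ Convex ℝ A ∧
    ∀ᵐ ω ∂(ProbabilityTheory.cond (configLaw d q) {ω | 1 ≤ ω 0}),
      ∀ ε : ℝ, 0 < ε → ε < 1 →
        ∀ᵐ s ∂(quenchedLaw ω), ∀ᶠ n : ℕ in atTop,
          (1 - ε) • A ⊆ (n : ℝ)⁻¹ • cubes (visited s 0 n) ∧
            (n : ℝ)⁻¹ • cubes (visited s 0 n) ⊆ (1 + ε) • A

/-- The full `ℓ¹` diamond in `ℝ^d`. -/
def diamond (d : ℕ) : Set (Fin d → ℝ) := {x | ∑ i, |x i| ≤ 1}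

end FrogModel

end

/-! The outer inclusion is deterministic: a walk moves by `ℓ¹` distance one per step, so `T(0,y) ≥
‖y‖₁`.

For the inner one, call a site crowded at scale `n` if it holds at least `(4d)^(4n)` particles. A
given particle follows a prescribed geodesic of length at most `4n` with probability at least
`(2d)^(-4n)`, so a crowded site reaches everything within distance `4n` at full speed, up to
probability `e^(-n)` per target (`quenchedLaw_real_lt_hitTime_le`, `ae_hitTime_le_norm1`). The
logarithm of the threshold is linear in `n`, so a site is crowded with probability at least `c
n^(-δ)`. As `δ < d`, a box of side of order `n` lacks crowded sites with probability at most
`exp(-c' n^(d-δ))`, which beats the polynomial number of boxes considered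
(`ae_exists_crowded_near`).

The particle at the origin supplies the start: its walk is unbounded and independent of the
configuration, hence meets a crowded site (`ae_ae_walk_visits_crowded`). From there activation
passes through crowded sites of growing scales, and then from scale `n/2` to scale `n` near the
origin. The delays add up geometrically to a small multiple of `n`, after which one crowded site
near the origin serves all targets at full speed (`exists_passageTime_le`). -/

open ProbabilityTheory

namespace FrogModel

/-! ### Lattice geometry -/

/-- The `ℓ¹` norm of a site. -/
def norm1 {d : ℕ} (x : Site d) : ℕ := ∑ i, (x i).natAbs

lemma norm1_add_le {d : ℕ} (x y : Site d) : norm1 (x + y) ≤ norm1 x + norm1 y := by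
  unfold norm1
  rw [← Finset.sum_add_distrib]
  exact Finset.sum_le_sum fun i _ => Int.natAbs_add_le _ _

@[simp] lemma norm1_zero {d : ℕ} : norm1 (0 : Site d) = 0 := by simp [norm1]

lemma norm1_sub_comm {d : ℕ} (x y : Site d) : norm1 (x - y) = norm1 (y - x) := by
  unfold norm1
  refine Finset.sum_congr rfl fun i _ => ?_
  rw [Pi.sub_apply, Pi.sub_apply]
  omega

lemma norm1_sub_le {d : ℕ} (x y z : Site d) :
    norm1 (x - z) ≤ norm1 (x - y) + norm1 (y - z) := by
  simpa using norm1_add_le (x - y) (y - z)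

lemma norm1_le_add_sub {d : ℕ} (x y : Site d) : norm1 x ≤ norm1 y + norm1 (x - y) := by
  simpa using norm1_add_le y (x - y)

lemma norm1_eq_zero {d : ℕ} {x : Site d} (h : norm1 x = 0) : x = 0 := by
  ext i
  have := (Finset.sum_eq_zero_iff.1 h) i (Finset.mem_univ i)
  simpa using this

lemma norm1_vec {d : ℕ} (s : Dir d) : norm1 s.vec = 1 := by
  unfold norm1 Dir.vec
  rw [Finset.sum_eq_single s.1]
  · rw [Pi.single_eq_same]; split_ifs <;> rfl
  · intro b _ hb
    rw [Pi.single_eq_of_ne hb]; rfl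
  · simp

/-- The position after `n` steps of the walk from the origin with step directions `γ`. -/
def pos {d : ℕ} (γ : ℕ → Dir d) (n : ℕ) : Site d := ∑ i ∈ Finset.range n, (γ i).vec

lemma pos_succ {d : ℕ} (γ : ℕ → Dir d) (n : ℕ) : pos γ (n + 1) = pos γ n + (γ n).vec :=
  Finset.sum_range_succ _ _

lemma norm1_pos_le {d : ℕ} (γ : ℕ → Dir d) (n : ℕ) : norm1 (pos γ n) ≤ n := by
  induction n with
  | zero => simp [pos]
  | succ n ih =>
    rw [pos_succ]
    have := norm1_add_le (pos γ n) (γ n).vec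
    rw [norm1_vec] at this
    omega

/-- Every site is reached from the origin by a walk of length its `ℓ¹` norm. -/
lemma exists_geodesic {d : ℕ} [NeZero d] (x : Site d) :
    ∃ γ : ℕ → Dir d, pos γ (norm1 x) = x := by
  induction h : norm1 x generalizing x with
  | zero => exact ⟨fun _ => (0, true), by simp [pos, norm1_eq_zero h]⟩
  | succ r ih =>
    obtain ⟨i, hi⟩ : ∃ i, x i ≠ 0 := by
      by_contra! hc
      have : x = 0 := funext hc
      simp [this] at h
    let e : Dir d := (i, decide (0 < x i))
    have hn : norm1 (x - e.vec) = r := by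
      have h1 : norm1 x = (x i).natAbs + ∑ j ∈ Finset.univ.erase i, (x j).natAbs :=
        (Finset.add_sum_erase _ _ (Finset.mem_univ i)).symm
      have h2 : norm1 (x - e.vec) = ((x - e.vec) i).natAbs
          + ∑ j ∈ Finset.univ.erase i, ((x - e.vec) j).natAbs :=
        (Finset.add_sum_erase _ _ (Finset.mem_univ i)).symm
      have h3 : ∑ j ∈ Finset.univ.erase i, ((x - e.vec) j).natAbs
          = ∑ j ∈ Finset.univ.erase i, (x j).natAbs := by
        refine Finset.sum_congr rfl fun j hj => ?_
        rw [Pi.sub_apply, Dir.vec, Pi.single_eq_of_ne (Finset.ne_of_mem_erase hj), sub_zero]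
      have h4 : (x - e.vec) i = x i - (if 0 < x i then 1 else -1) := by
        simp [e, Dir.vec]
      rw [h3, h4] at h2
      split_ifs at h2 <;> omega
    obtain ⟨γ, hγ⟩ := ih _ hn
    refine ⟨fun j => if j < r then γ j else e, ?_⟩
    rw [pos_succ]
    have : pos (fun j => if j < r then γ j else e) r = pos γ r :=
      Finset.sum_congr rfl fun j hj => by
        simp only [if_pos (Finset.mem_range.1 hj)]
    rw [this, hγ]
    simp

/-- The box `z + [a, b]^d`. -/
noncomputable def box {d : ℕ} (z : Site d) (a b : ℤ) : Finset (Site d) :=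
  Fintype.piFinset fun i => Finset.Icc (z i + a) (z i + b)

lemma card_box {d : ℕ} (z : Site d) (a b : ℤ) : (box z a b).card = (b + 1 - a).toNat ^ d := by
  simp only [box, Fintype.card_piFinset, Int.card_Icc]
  rw [Finset.prod_congr rfl (g := fun _ => (b + 1 - a).toNat)]
  · simp
  · intro i _; congr 1; ring

lemma mem_box_of_norm1_le {d : ℕ} {x : Site d} {r : ℕ} (h : norm1 x ≤ r) :
    x ∈ box 0 (-(r : ℤ)) r := by
  rw [box, Fintype.mem_piFinset]
  intro i
  have : (x i).natAbs ≤ norm1 x :=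
    Finset.single_le_sum (f := fun i => (x i).natAbs) (fun _ _ => Nat.zero_le _)
      (Finset.mem_univ i)
  rw [Finset.mem_Icc, Pi.zero_apply]
  omega

lemma card_box_symm_le {d : ℕ} {n k : ℕ} (hn : 1 ≤ n) :
    (box (0 : Site d) (-((n ^ k : ℕ) : ℤ)) ((n ^ k : ℕ) : ℤ)).card ≤ 3 ^ d * n ^ (k * d) := by
  rw [card_box, pow_mul, ← mul_pow]
  refine Nat.pow_le_pow_left ?_ d
  have := Nat.one_le_pow k n hn
  omega

lemma norm1_sub_le_of_mem_box {d : ℕ} {x z : Site d} {r : ℕ} (h : x ∈ box z 0 r) :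
    norm1 (x - z) ≤ d * r := by
  rw [box, Fintype.mem_piFinset] at h
  calc norm1 (x - z) ≤ ∑ _i : Fin d, r := by
        refine Finset.sum_le_sum fun i _ => ?_
        have := h i
        rw [Finset.mem_Icc] at this
        rw [Pi.sub_apply]
        omega
    _ = d * r := by simp

/-- An unbounded walk from the origin visits every `ℓ¹` sphere. -/
lemma exists_norm1_pos_eq {d : ℕ} {γ : ℕ → Dir d} (h : ∀ R, ∃ n, R ≤ norm1 (pos γ n)) (r : ℕ) :
    ∃ n, norm1 (pos γ n) = r := by
  classical
  -- At the first time the norm is at least `r` it equals `r`, since one step changes the norm by at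
  -- most one.
  refine ⟨Nat.find (h r), le_antisymm ?_ (Nat.find_spec (h r))⟩
  rcases hn : Nat.find (h r) with _ | n
  · simp [pos]
  · have h1 : norm1 (pos γ n) < r := by
      have := Nat.find_min (h r) (m := n) (by omega)
      omega
    have h2 := norm1_add_le (pos γ n) (γ n).vec
    rw [norm1_vec] at h2
    rw [pos_succ]
    omega

/-! ### Probabilistic tools -/

lemma summable_pow_mul_exp (k : ℕ) {c a : ℝ} (hc : 0 < c) (ha : 0 < a) :
    Summable fun n : ℕ => (n : ℝ) ^ k * Real.exp (-c * (n : ℝ) ^ a) := by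
  -- In the variable `n ^ a`, the power `-(k + 2) / a` is `n ^ (-(k + 2))`, so the summand is
  -- `O(n⁻²)`.
  have h1 := (isLittleO_exp_neg_mul_rpow_atTop hc (-(k + 2) / a)).comp_tendsto
    ((tendsto_rpow_atTop ha).comp tendsto_natCast_atTop_atTop)
  have h2 : (fun n : ℕ => (n : ℝ) ^ k * Real.exp (-c * (n : ℝ) ^ a)) =O[atTop]
      fun n : ℕ => (n : ℝ) ^ (-2 : ℝ) := by
    have h3 := (Asymptotics.isBigO_refl (fun n : ℕ => (n : ℝ) ^ k) atTop).mul h1.isBigO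
    refine h3.trans (Asymptotics.IsBigO.of_bound 1 ?_)
    filter_upwards [eventually_ge_atTop 1] with n hn
    have hn' : (0 : ℝ) < n := by exact_mod_cast hn
    rw [one_mul]
    apply le_of_eq
    congr 1
    simp only [Function.comp_apply]
    rw [← Real.rpow_mul hn'.le, ← Real.rpow_natCast, ← Real.rpow_add hn']
    congr 1
    field_simp
    ring
  exact summable_of_isBigO_nat (Real.summable_nat_rpow.2 (by norm_num)) h2

/-- The first Borel–Cantelli lemma for probabilities decaying like a stretched exponential. -/
lemma ae_eventually_notMem_of_le_exp {Ω : Type*} [MeasurableSpace Ω] {μ : Measure Ω}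
    [IsProbabilityMeasure μ] {B : ℕ → Set Ω} {C c a : ℝ} {k : ℕ} (hc : 0 < c) (ha : 0 < a)
    (h : ∀ᶠ n : ℕ in atTop, μ.real (B n) ≤ C * (n : ℝ) ^ k * Real.exp (-c * (n : ℝ) ^ a)) :
    ∀ᵐ x ∂μ, ∀ᶠ n in atTop, x ∉ B n := by
  have hs : Summable fun n => μ.real (B n) := by
    have := (summable_pow_mul_exp k hc ha).mul_left C
    refine Summable.of_norm_bounded_eventually_nat this ?_
    filter_upwards [h] with n hn
    rw [Real.norm_of_nonneg measureReal_nonneg]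
    simpa [mul_assoc] using hn
  refine ae_eventually_notMem ?_
  have : ∀ n, μ (B n) = ENNReal.ofReal (μ.real (B n)) := fun n => by
    simp [Measure.real]
  simp_rw [this]
  exact hs.tsum_ofReal_ne_top

lemma one_sub_pow_le_exp {p : ℝ} (hp1 : p ≤ 1) (n : ℕ) :
    (1 - p) ^ n ≤ Real.exp (-(n * p)) := by
  calc (1 - p) ^ n ≤ Real.exp (-p) ^ n :=
        pow_le_pow_left₀ (by linarith) (Real.one_sub_le_exp_neg p) n
    _ = Real.exp (-(n * p)) := by rw [← Real.exp_nat_mul]; congr 1; ring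

/-- The probability that all of finitely many independent coordinates avoid events of probability
at least `p`. -/
lemma infinitePi_real_forall_notMem_le {ι X : Type*} [MeasurableSpace X] (μ : Measure X)
    [IsProbabilityMeasure μ] {A : Set X} (hA : MeasurableSet A) (F : Finset ι) :
    (Measure.infinitePi fun _ : ι => μ).real {ω | ∀ x ∈ F, ω x ∉ A} ≤
      Real.exp (-(F.card * μ.real A)) := by
  have h : {ω : ι → X | ∀ x ∈ F, ω x ∉ A} = Set.pi (F : Set ι) fun _ => Aᶜ := by
    ext; simp [Set.pi]
  rw [h, Measure.real, Measure.infinitePi_pi _ (fun _ _ => hA.compl), Finset.prod_const,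
    ENNReal.toReal_pow, ← Measure.real, probReal_compl_eq_one_sub hA]
  exact one_sub_pow_le_exp measureReal_le_one _

/-! ### Simple random walk: cylinder probabilities and unboundedness -/

lemma stepLaw_singleton {d : ℕ} [NeZero d] (e : Dir d) :
    stepLaw d {e} = ((2 * d : ℕ) : ENNReal)⁻¹ := by
  rw [stepLaw, uniformOn_univ, Measure.count_singleton, one_div]
  congr 2
  simp [mul_comm]

lemma infinitePi_stepLaw_cylinder {d : ℕ} [NeZero d] (S : Finset ℕ) (g : ℕ → Dir d) :
    Measure.infinitePi (fun _ : ℕ => stepLaw d) {γ | ∀ i ∈ S, γ i = g i} =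
      (((2 * d : ℕ) : ENNReal)⁻¹) ^ S.card := by
  have h : {γ : ℕ → Dir d | ∀ i ∈ S, γ i = g i} = Set.pi (S : Set ℕ) fun i => {g i} := by
    ext; simp [Set.pi]
  rw [h, Measure.infinitePi_pi _ (fun _ _ => measurableSet_singleton _)]
  simp [stepLaw_singleton]

lemma measurableSet_cylinder {d : ℕ} (S : Finset ℕ) (g : ℕ → Dir d) :
    MeasurableSet {γ : ℕ → Dir d | ∀ i ∈ S, γ i = g i} := by
  have h : {γ : ℕ → Dir d | ∀ i ∈ S, γ i = g i} = Set.pi (S : Set ℕ) fun i => {g i} := by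
    ext; simp [Set.pi]
  rw [h]
  exact MeasurableSet.pi S.countable_toSet fun _ _ => measurableSet_singleton _

/-- Almost surely there are arbitrarily long runs of equal steps. -/
lemma ae_exists_run {d : ℕ} [NeZero d] (e : Dir d) (l : ℕ) :
    ∀ᵐ γ ∂(Measure.infinitePi fun _ : ℕ => stepLaw d),
      ∃ a, ∀ i, a ≤ i → i < a + l → γ i = e := by
  -- Runs filling disjoint blocks of length `l` are independent with a common positive probability,
  -- so the second Borel–Cantelli lemma applies.
  let I : ℕ → Finset ℕ := fun j => Finset.Ico (j * l) (j * l + l)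
  let A : ℕ → Set (ℕ → Dir d) := fun j => {γ | ∀ i ∈ I j, γ i = e}
  have hA : ∀ j, MeasurableSet (A j) := fun j => measurableSet_cylinder (I j) fun _ => e
  have hcard : ∀ j, (I j).card = l := fun j => by simp [I]
  have hdisj : Pairwise fun j k => Disjoint (I j) (I k) := by
    have key : ∀ j k, j < k → Disjoint (I j) (I k) := fun j k hjk => by
      rw [Finset.disjoint_left]
      intro x hx hy
      simp only [I, Finset.mem_Ico] at hx hy
      have : (j + 1) * l ≤ k * l := Nat.mul_le_mul_right l hjk
      rw [add_mul] at this
      omega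
    intro j k hjk
    rcases lt_or_gt_of_ne hjk with h | h
    · exact key j k h
    · exact (key k j h).symm
  have hmeas : ∀ j, Measure.infinitePi (fun _ : ℕ => stepLaw d) (A j) =
      (((2 * d : ℕ) : ENNReal)⁻¹) ^ l := fun j => by
    rw [← hcard j]
    exact infinitePi_stepLaw_cylinder (I j) fun _ => e
  have hind : iIndepSet A (Measure.infinitePi fun _ : ℕ => stepLaw d) := by
    rw [iIndepSet_iff_meas_biInter hA]
    intro S
    have h1 : ⋂ j ∈ S, A j = {γ | ∀ i ∈ S.biUnion I, γ i = e} := by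
      ext γ
      simp only [A, Set.mem_iInter, Set.mem_ofPred_eq, Finset.mem_biUnion]
      exact ⟨fun h i ⟨j, hj, hi⟩ => h j hj i hi, fun h j hj i hi => h i ⟨j, hj, hi⟩⟩
    rw [h1, infinitePi_stepLaw_cylinder (S.biUnion I) fun _ => e,
      Finset.card_biUnion fun j _ k _ hjk => hdisj hjk, Finset.prod_congr rfl fun j _ => hmeas j,
      Finset.sum_congr rfl fun j _ => hcard j]
    simp [pow_mul, mul_comm]
  have hlim := measure_limsup_eq_one hA hind (by
    simp_rw [hmeas]
    refine ENNReal.tsum_const_eq_top_of_ne_zero (pow_ne_zero _ ?_)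
    exact ENNReal.inv_ne_zero.2 (ENNReal.natCast_ne_top _))
  have hlim' := (mem_ae_iff_prob_eq_one (MeasurableSet.measurableSet_limsup hA)).2 hlim
  filter_upwards [hlim'] with γ hγ
  rw [mem_limsup_iff_frequently_mem] at hγ
  obtain ⟨j, hj⟩ := hγ.exists
  exact ⟨j * l, fun i hi hi' => hj i (Finset.mem_Ico.2 ⟨hi, hi'⟩)⟩

lemma pos_add_of_run {d : ℕ} {γ : ℕ → Dir d} {e : Dir d} {a l : ℕ}
    (h : ∀ i, a ≤ i → i < a + l → γ i = e) : pos γ (a + l) = pos γ a + l • e.vec := by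
  induction l with
  | zero => simp
  | succ l ih =>
    rw [← add_assoc, pos_succ, ih fun i hi hi' => h i hi (by omega), h (a + l) (by omega) (by omega),
      succ_nsmul, add_assoc]

lemma norm1_nsmul {d : ℕ} (l : ℕ) (x : Site d) : norm1 (l • x) = l * norm1 x := by
  simp [norm1, Finset.mul_sum, Int.natAbs_mul]

/-- Simple random walk is almost surely unbounded. -/
lemma ae_unbounded_pos {d : ℕ} [NeZero d] :
    ∀ᵐ γ ∂(Measure.infinitePi fun _ : ℕ => stepLaw d), ∀ R, ∃ n, R ≤ norm1 (pos γ n) := by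
  rw [ae_all_iff]
  intro R
  filter_upwards [ae_exists_run ((0 : Fin d), true) (2 * R)] with γ ⟨a, ha⟩
  -- A run of length `2R` displaces the walk by exactly `2R`, so its two endpoints cannot both have
  -- norm below `R`.
  by_contra! hc
  have h1 := hc a
  have h2 := hc (a + 2 * R)
  have h3 := norm1_sub_le (pos γ (a + 2 * R)) 0 (pos γ a)
  rw [pos_add_of_run ha] at h2 h3
  rw [norm1_sub_comm 0] at h3
  simp only [add_sub_cancel_left, norm1_nsmul, norm1_vec, sub_zero] at h3
  omega

/-- The number of particles at a site that ensures that all sites within distance `4 n` are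
visited at full speed. -/
def threshold (d n : ℕ) : ℕ := (4 * d) ^ (4 * n)

/-! ### The initial configuration -/

/-- Since `log (threshold d n) = 4 n log (4 d)` is linear in `n`, the logarithmic tail becomes
polynomial in the scale `n`. -/
lemma eventually_le_tail {d : ℕ} [NeZero d] {q : Measure ℕ} {δ : ℝ}
    (hq : ∀ᶠ n : ℕ in atTop, (Real.log n) ^ (-δ) ≤ q.real {m | n ≤ m}) :
    ∃ c : ℝ, 0 < c ∧ ∀ᶠ n : ℕ in atTop,
      c * (n : ℝ) ^ (-δ) ≤ q.real {m | threshold d n ≤ m} := by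
  have hd : 1 ≤ d := Nat.one_le_iff_ne_zero.2 (NeZero.ne d)
  have hlog : 0 < Real.log ((4 * d : ℕ) : ℝ) :=
    Real.log_pos (by exact_mod_cast (by omega : 1 < 4 * d))
  refine ⟨(4 * Real.log ((4 * d : ℕ) : ℝ)) ^ (-δ), by positivity, ?_⟩
  have ht : Tendsto (threshold d) atTop atTop := by
    have h1 : Tendsto (fun n : ℕ => 4 * n) atTop atTop :=
      tendsto_id.const_mul_atTop' (by norm_num)
    exact (tendsto_pow_atTop_atTop_of_one_lt (by omega : 1 < 4 * d)).comp h1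
  filter_upwards [ht.eventually hq] with n hn
  rw [← Real.mul_rpow (by positivity) (by positivity)]
  convert hn using 2
  rw [threshold, Nat.cast_pow, Real.log_pow]
  push_cast
  ring

lemma configLaw_real_forall_lt_le {d : ℕ} (q : Measure ℕ) [IsProbabilityMeasure q]
    (F : Finset (Site d)) (N : ℕ) :
    (configLaw d q).real {ω | ∀ x ∈ F, ω x < N} ≤
      Real.exp (-(F.card * q.real {m | N ≤ m})) := by
  have := infinitePi_real_forall_notMem_le q (A := {m | N ≤ m}) (MeasurableSet.of_discrete) F
  simpa [configLaw] using this

instance {d : ℕ} (q : Measure ℕ) [IsProbabilityMeasure q] :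
    IsProbabilityMeasure (configLaw d q) := by
  unfold configLaw; infer_instance

/-- Near every site that is not too far from the origin there is a crowded site. -/
lemma ae_exists_crowded_near {d : ℕ} [NeZero d] {q : Measure ℕ} [IsProbabilityMeasure q] {δ : ℝ}
    (hδd : δ < d) (hq : ∀ᶠ n : ℕ in atTop, (Real.log n) ^ (-δ) ≤ q.real {m | n ≤ m})
    {m : ℕ} (hm : 1 ≤ m) :
    ∀ᵐ ω ∂(configLaw d q), ∀ᶠ n in atTop, ∀ z : Site d, norm1 z ≤ n ^ (d + 1) →
      ∃ x, m * norm1 (x - z) ≤ n ∧ threshold d n ≤ ω x := by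
  have hd : 1 ≤ d := Nat.one_le_iff_ne_zero.2 (NeZero.ne d)
  obtain ⟨c, hc, hev⟩ := eventually_le_tail (d := d) hq
  let F : ℕ → Finset (Site d) := fun n =>
    box 0 (-((n ^ (d + 1) : ℕ) : ℤ)) ((n ^ (d + 1) : ℕ) : ℤ)
  -- The side `n / (m * d)` keeps every site of the box within `ℓ¹` distance `n / m` of its corner
  -- `z`.
  let D : ℕ → Site d → Set (Config d) := fun n z =>
    {ω | ∀ x ∈ box z 0 ((n / (m * d) : ℕ) : ℤ), ω x < threshold d n}
  have hbound := ae_eventually_notMem_of_le_exp (μ := configLaw d q)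
    (B := fun n => ⋃ z ∈ F n, D n z) (C := 3 ^ d) (k := (d + 1) * d)
    (c := c * ((m * d : ℕ) : ℝ)⁻¹ ^ d) (a := d - δ) (by positivity) (by linarith) (by
      filter_upwards [hev, eventually_ge_atTop 1] with n hn hn1
      have hn0 : (0 : ℝ) < n := by exact_mod_cast hn1
      have hD : ∀ z, (configLaw d q).real (D n z) ≤
          Real.exp (-(c * ((m * d : ℕ) : ℝ)⁻¹ ^ d) * (n : ℝ) ^ (d - δ)) := fun z => by
        refine (configLaw_real_forall_lt_le q _ _).trans (Real.exp_le_exp.2 ?_)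
        rw [neg_mul, neg_le_neg_iff]
        -- The box has `n / (m * d) + 1` sites along each side; the extra one absorbs the rounding
        -- of the division.
        have h1 : (n : ℝ) * ((m * d : ℕ) : ℝ)⁻¹ ≤ ((n / (m * d) + 1 : ℕ) : ℝ) := by
          rw [← div_eq_mul_inv]
          have hmd : 0 < m * d := by positivity
          rw [div_le_iff₀ (by exact_mod_cast hmd)]
          have := Nat.lt_div_mul_add hmd (a := n)
          have h : n ≤ (n / (m * d) + 1) * (m * d) := by rw [add_mul]; omega
          exact_mod_cast h
        have h2 : (box z 0 ((n / (m * d) : ℕ) : ℤ)).card = (n / (m * d) + 1) ^ d := by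
          rw [card_box]; congr 1
        rw [h2]
        calc c * ((m * d : ℕ) : ℝ)⁻¹ ^ d * (n : ℝ) ^ (d - δ)
            = (n * ((m * d : ℕ) : ℝ)⁻¹) ^ d * (c * (n : ℝ) ^ (-δ)) := by
              rw [mul_pow, sub_eq_add_neg, Real.rpow_add hn0, Real.rpow_natCast]; ring
          _ ≤ _ := by
              push_cast at h1 ⊢
              gcongr
      calc (configLaw d q).real (⋃ z ∈ F n, D n z)
          ≤ ∑ z ∈ F n, (configLaw d q).real (D n z) := measureReal_biUnion_finset_le _ _
        _ ≤ ∑ _z ∈ F n, Real.exp (-(c * ((m * d : ℕ) : ℝ)⁻¹ ^ d) * (n : ℝ) ^ (d - δ)) :=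
            Finset.sum_le_sum fun z _ => hD z
        _ ≤ 3 ^ d * (n : ℝ) ^ ((d + 1) * d) *
              Real.exp (-(c * ((m * d : ℕ) : ℝ)⁻¹ ^ d) * (n : ℝ) ^ (d - δ)) := by
            rw [Finset.sum_const, nsmul_eq_mul]
            gcongr
            exact_mod_cast card_box_symm_le hn1)
  filter_upwards [hbound] with ω hω
  filter_upwards [hω] with n hn z hz
  by_contra! hc
  refine hn (Set.mem_biUnion (x := z) (mem_box_of_norm1_le hz) fun x hx => hc x ?_)
  calc m * norm1 (x - z) ≤ m * (d * (n / (m * d))) :=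
        Nat.mul_le_mul_left _ (norm1_sub_le_of_mem_box hx)
    _ = (m * d) * (n / (m * d)) := by ring
    _ ≤ n := Nat.mul_div_le _ _

/-- An unbounded walk visits crowded sites not too far from the origin. -/
lemma ae_walk_visits_crowded {d : ℕ} [NeZero d] {q : Measure ℕ} [IsProbabilityMeasure q] {δ : ℝ}
    (hδd : δ < d) (hq : ∀ᶠ n : ℕ in atTop, (Real.log n) ^ (-δ) ≤ q.real {m | n ≤ m})
    {γ : ℕ → Dir d} (hγ : ∀ R, ∃ n, R ≤ norm1 (pos γ n)) :
    ∀ᵐ ω ∂(configLaw d q), ∀ᶠ n in atTop,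
      ∃ j, norm1 (pos γ j) ≤ n ^ (d + 1) ∧ threshold d n ≤ ω (pos γ j) := by
  classical
  obtain ⟨c, hc, hev⟩ := eventually_le_tail (d := d) hq
  choose J hJ using exists_norm1_pos_eq hγ
  -- One visited site on each sphere of radius at most `n ^ (d + 1)`: these are distinct because
  -- their norms are, which gives `n ^ (d + 1) + 1` independent chances of being crowded.
  let F : ℕ → Finset (Site d) := fun n => (Finset.range (n ^ (d + 1) + 1)).image fun r => pos γ (J r)
  have hF : ∀ n, (F n).card = n ^ (d + 1) + 1 := fun n => by
    rw [Finset.card_image_of_injective _ fun r r' h => ?_, Finset.card_range]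
    rw [← hJ r, ← hJ r']
    exact congrArg norm1 h
  have hbound := ae_eventually_notMem_of_le_exp (μ := configLaw d q)
    (B := fun n => {ω | ∀ x ∈ F n, ω x < threshold d n}) (C := 1) (k := 0)
    (c := c) (a := d + 1 - δ) hc (by linarith) (by
      filter_upwards [hev, eventually_ge_atTop 1] with n hn hn1
      have hn0 : (0 : ℝ) < n := by exact_mod_cast hn1
      refine (configLaw_real_forall_lt_le q _ _).trans ?_
      rw [pow_zero, one_mul, one_mul, Real.exp_le_exp, neg_mul, neg_le_neg_iff, hF]
      calc c * (n : ℝ) ^ (d + 1 - δ) = (n : ℝ) ^ (d + 1) * (c * (n : ℝ) ^ (-δ)) := by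
            rw [sub_eq_add_neg, Real.rpow_add hn0, ← Nat.cast_add_one, Real.rpow_natCast]; ring
        _ ≤ _ := by
            push_cast
            gcongr
            linarith)
  filter_upwards [hbound] with ω hω
  filter_upwards [hω] with n hn
  by_contra! hc
  refine hn fun x hx => ?_
  obtain ⟨r, hr, rfl⟩ := Finset.mem_image.1 hx
  exact hc _ (by rw [hJ]; exact Nat.lt_succ_iff.1 (Finset.mem_range.1 hr))

/-- Joint measurability is what permits exchanging the almost-sure quantifiers over walks and
configurations. -/
lemma measurableSet_walk_visits_crowded (d : ℕ) :
    MeasurableSet {p : (ℕ → Dir d) × Config d | ∀ᶠ n in atTop,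
      ∃ j, norm1 (pos p.1 j) ≤ n ^ (d + 1) ∧ threshold d n ≤ p.2 (pos p.1 j)} := by
  have hpos : ∀ j, Measurable fun p : (ℕ → Dir d) × Config d => pos p.1 j := fun j => by
    unfold pos
    refine Finset.measurable_sum _ fun i _ => ?_
    exact (measurable_of_countable Dir.vec).comp ((measurable_pi_apply i).comp measurable_fst)
  simp only [eventually_atTop]
  refine measurableSet_setOfPred.2 <| Measurable.exists fun a => Measurable.forall fun n =>
    Measurable.imp measurable_const <| Measurable.exists fun j => Measurable.and ?_ ?_
  · exact (measurable_of_countable fun z : Site d => norm1 z ≤ n ^ (d + 1)).comp (hpos j)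
  · refine measurableSet_setOfPred.1 ?_
    -- The configuration is evaluated at a random site; splitting over the countably many values of
    -- that site leaves fixed coordinates.
    have : {p : (ℕ → Dir d) × Config d | threshold d n ≤ p.2 (pos p.1 j)} =
        ⋃ z : Site d, {p | pos p.1 j = z} ∩ {p | threshold d n ≤ p.2 z} := by
      ext p; simp
    rw [this]
    refine MeasurableSet.iUnion fun z => ?_
    exact (hpos j (measurableSet_singleton z)).inter
      (measurableSet_le measurable_const ((measurable_pi_apply z).comp measurable_snd))

/-- In almost every configuration, a simple random walk almost surely visits crowded sites not
too far from the origin. -/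
lemma ae_ae_walk_visits_crowded {d : ℕ} [NeZero d] {q : Measure ℕ} [IsProbabilityMeasure q]
    {δ : ℝ} (hδd : δ < d)
    (hq : ∀ᶠ n : ℕ in atTop, (Real.log n) ^ (-δ) ≤ q.real {m | n ≤ m}) :
    ∀ᵐ ω ∂(configLaw d q), ∀ᵐ γ ∂(Measure.infinitePi fun _ : ℕ => stepLaw d), ∀ᶠ n in atTop,
      ∃ j, norm1 (pos γ j) ≤ n ^ (d + 1) ∧ threshold d n ≤ ω (pos γ j) := by
  -- The law of a single walk does not depend on `ω`, so Fubini allows fixing the trajectory first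
  -- and drawing the configuration afterwards.
  rw [← Measure.ae_ae_comm (measurableSet_walk_visits_crowded d)]
  filter_upwards [ae_unbounded_pos] with γ hγ
  exact ae_walk_visits_crowded hδd hq hγ

/-! ### The walks -/

instance {d : ℕ} [NeZero d] (ω : Config d) : IsProbabilityMeasure (quenchedLaw ω) := by
  unfold quenchedLaw; infer_instance

lemma walk_eq {d : ℕ} {ω : Config d} (s : PathSpace ω) (p : Particle ω) (n : ℕ) :
    walk s p n = p.1 + pos (s p) n := rfl

lemma hitTime_le {d : ℕ} {ω : Config d} {s : PathSpace ω} {x z : Site d} {n : ℕ} (k : Fin (ω x))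
    (h : walk s ⟨x, k⟩ n = z) : hitTime s x z ≤ n :=
  iInf₂_le n ⟨k, h⟩

/-- The probability that a site at distance at most `4 n` of a crowded site is not visited at
full speed. -/
lemma quenchedLaw_real_lt_hitTime_le {d : ℕ} [NeZero d] {ω : Config d} {n : ℕ} {x v : Site d}
    (hx : threshold d n ≤ ω x) (hv : norm1 v ≤ 4 * n) :
    (quenchedLaw ω).real {s | ¬ hitTime s x (x + v) ≤ norm1 v} ≤ Real.exp (-n) := by
  have hd : 1 ≤ d := Nat.one_le_iff_ne_zero.2 (NeZero.ne d)
  obtain ⟨g, hg⟩ := exists_geodesic v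
  -- It suffices that one of the particles at `x` follows the fixed geodesic `g` step by step.
  let A : Set (ℕ → Dir d) := {γ | ∀ i ∈ Finset.range (norm1 v), γ i = g i}
  let F : Finset (Particle ω) := Finset.univ.map ⟨fun k : Fin (ω x) => (⟨x, k⟩ : Particle ω),
    fun k k' h => by simpa using h⟩
  have hF : F.card = ω x := by simp [F]
  have hA : (Measure.infinitePi fun _ : ℕ => stepLaw d).real A =
      (((2 * d : ℕ) : ℝ)⁻¹) ^ norm1 v := by
    rw [Measure.real, infinitePi_stepLaw_cylinder]
    simp
  have hsub : {s : PathSpace ω | ¬ hitTime s x (x + v) ≤ norm1 v} ⊆ {s | ∀ p ∈ F, s p ∉ A} := by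
    intro s hs p hp hpA
    obtain ⟨k, -, rfl⟩ := Finset.mem_map.1 hp
    refine hs (hitTime_le k ?_)
    rw [walk_eq, ← hg, hg]
    conv_rhs => rw [← hg]
    congr 1
    exact Finset.sum_congr rfl fun i hi => congrArg Dir.vec (hpA i hi)
  refine (measureReal_mono hsub).trans ((infinitePi_real_forall_notMem_le _
    (measurableSet_cylinder _ _) F).trans (Real.exp_le_exp.2 (neg_le_neg ?_)))
  rw [hF, hA]
  have h2d : (1 : ℝ) ≤ ((2 * d : ℕ) : ℝ) := by exact_mod_cast (by omega : 1 ≤ 2 * d)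
  -- The base `4 d` is twice the number of directions, so the expected number of successful
  -- particles is at least `2 ^ (4 n) ≥ n`.
  calc (n : ℝ) ≤ (2 : ℝ) ^ (4 * n) := by
        have : n < 2 ^ (4 * n) := lt_of_lt_of_le n.lt_two_pow_self
          (Nat.pow_le_pow_right (by norm_num) (by omega))
        exact_mod_cast this.le
    _ = (threshold d n : ℝ) * (((2 * d : ℕ) : ℝ)⁻¹) ^ (4 * n) := by
        rw [threshold, Nat.cast_pow, ← mul_pow]
        congr 1
        push_cast
        field_simp
        norm_num
    _ ≤ (ω x : ℝ) * (((2 * d : ℕ) : ℝ)⁻¹) ^ norm1 v := by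
        refine mul_le_mul (by exact_mod_cast hx) ?_ (by positivity) (by positivity)
        exact pow_le_pow_of_le_one (by positivity) (inv_le_one_of_one_le₀ h2d) hv

/-- Eventually, all crowded sites that are not too far from the origin emit particles at full
speed in all directions. -/
lemma ae_hitTime_le_norm1 {d : ℕ} [NeZero d] (ω : Config d) :
    ∀ᵐ s ∂(quenchedLaw ω), ∀ᶠ n in atTop, ∀ x y : Site d, norm1 x ≤ n ^ (d + 2) →
      threshold d n ≤ ω x → norm1 (y - x) ≤ 4 * n → hitTime s x y ≤ norm1 (y - x) := by
  classical
  let F : ℕ → Finset (Site d) := fun n =>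
    (box 0 (-((n ^ (d + 2) : ℕ) : ℤ)) ((n ^ (d + 2) : ℕ) : ℤ)).filter fun x => threshold d n ≤ ω x
  -- The box of radius `n ^ 3` only makes the set of displacements finite and polynomially large; it
  -- contains the ball of radius `4 n` once `n ≥ 2`.
  let G : ℕ → Finset (Site d) := fun n =>
    (box 0 (-((n ^ 3 : ℕ) : ℤ)) ((n ^ 3 : ℕ) : ℤ)).filter fun v => norm1 v ≤ 4 * n
  let D : Site d × Site d → Set (PathSpace ω) := fun p =>
    {s | ¬ hitTime s p.1 (p.1 + p.2) ≤ norm1 p.2}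
  have hbound := ae_eventually_notMem_of_le_exp (μ := quenchedLaw ω)
    (B := fun n => ⋃ p ∈ F n ×ˢ G n, D p) (C := 3 ^ d * 3 ^ d) (k := (d + 2) * d + 3 * d)
    (c := 1) (a := 1) one_pos one_pos (by
      filter_upwards [eventually_ge_atTop 1] with n hn1
      calc (quenchedLaw ω).real (⋃ p ∈ F n ×ˢ G n, D p)
          ≤ ∑ p ∈ F n ×ˢ G n, (quenchedLaw ω).real (D p) := measureReal_biUnion_finset_le _ _
        _ ≤ ∑ _p ∈ F n ×ˢ G n, Real.exp (-n) := Finset.sum_le_sum fun p hp => by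
            obtain ⟨hp1, hp2⟩ := Finset.mem_product.1 hp
            exact quenchedLaw_real_lt_hitTime_le (Finset.mem_filter.1 hp1).2
              (Finset.mem_filter.1 hp2).2
        _ ≤ _ := by
            rw [Finset.sum_const, nsmul_eq_mul, Real.rpow_one, neg_one_mul]
            gcongr
            have h1 : (F n).card ≤ 3 ^ d * n ^ ((d + 2) * d) :=
              (Finset.card_filter_le _ _).trans (card_box_symm_le hn1)
            have h2 : (G n).card ≤ 3 ^ d * n ^ (3 * d) :=
              (Finset.card_filter_le _ _).trans (card_box_symm_le hn1)
            rw [Finset.card_product]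
            calc (((F n).card * (G n).card : ℕ) : ℝ)
                ≤ ((3 ^ d * n ^ ((d + 2) * d) * (3 ^ d * n ^ (3 * d)) : ℕ) : ℝ) := by
                  exact_mod_cast Nat.mul_le_mul h1 h2
              _ = _ := by push_cast; ring)
  filter_upwards [hbound] with s hs
  filter_upwards [hs, eventually_ge_atTop 2] with n hn hn2 x y hx hωx hxy
  by_contra hc
  refine hn (Set.mem_biUnion (x := (x, y - x)) (Finset.mem_coe.2 (Finset.mem_product.2
    ⟨Finset.mem_filter.2 ⟨mem_box_of_norm1_le hx, hωx⟩,
      Finset.mem_filter.2 ⟨mem_box_of_norm1_le (hxy.trans ?_), hxy⟩⟩)) ?_)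
  · calc 4 * n = 2 * 2 * n := rfl
      _ ≤ n * n * n := by gcongr
      _ = n ^ 3 := by ring
  · simpa [D] using hc

/-! ### Passage times -/

lemma passageTime_le_of_hitTime_le {d : ℕ} {ω : Config d} {s : PathSpace ω} {x y z : Site d}
    {a b : ℕ} (hxy : passageTime s x y ≤ a) (hyz : hitTime s y z ≤ b) :
    passageTime s x z ≤ (a + b : ℕ) := by
  -- The strict bound by `a + 1` yields an actual chain of total time at most `a`, to which `z` is
  -- appended.
  have h1 : passageTime s x y < (a + 1 : ℕ) :=
    lt_of_le_of_lt hxy (by exact_mod_cast Nat.lt_succ_self a)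
  simp only [passageTime, iInf_lt_iff] at h1
  obtain ⟨m, u, ⟨hm, h0, hu⟩, hlt⟩ := h1
  have hle : ∑ i ∈ Finset.range m, hitTime s (u i) (u (i + 1)) ≤ a := by
    rw [Nat.cast_add_one] at hlt
    exact Order.le_of_lt_add_one hlt
  unfold passageTime
  refine iInf_le_of_le (m + 1) (iInf_le_of_le (fun i => if i ≤ m then u i else z)
    (iInf_le_of_le ⟨by omega, by simp [h0], by simp⟩ ?_))
  rw [Finset.sum_range_succ, Nat.cast_add]
  refine add_le_add (le_trans (Finset.sum_le_sum fun i hi => ?_) hle) ?_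
  · have hi := Finset.mem_range.1 hi
    simp only [if_pos hi.le, if_pos (Nat.succ_le_of_lt hi), le_refl]
  · simpa [hu] using hyz

lemma passageTime_le_hitTime {d : ℕ} {ω : Config d} (s : PathSpace ω) (x z : Site d) :
    passageTime s x z ≤ hitTime s x z := by
  unfold passageTime
  exact iInf_le_of_le 1 (iInf_le_of_le (fun i => if i = 0 then x else z)
    (iInf_le_of_le ⟨le_rfl, by simp, by simp⟩ (by simp)))

lemma norm1_sub_le_hitTime {d : ℕ} {ω : Config d} (s : PathSpace ω) (x z : Site d) :
    (norm1 (z - x) : ℕ∞) ≤ hitTime s x z := by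
  refine le_iInf₂ fun n ⟨k, hk⟩ => ?_
  rw [← hk, walk_eq, add_sub_cancel_left]
  exact_mod_cast norm1_pos_le _ _

/-- No particle outruns unit speed, and the triangle inequality carries this over to chains of
particles. -/
lemma norm1_sub_le_passageTime {d : ℕ} {ω : Config d} (s : PathSpace ω) (x z : Site d) :
    (norm1 (z - x) : ℕ∞) ≤ passageTime s x z := by
  refine le_iInf fun m => le_iInf₂ fun u ⟨_, h0, hm⟩ => ?_
  have key : ∀ j, (norm1 (u j - u 0) : ℕ∞) ≤
      ∑ i ∈ Finset.range j, hitTime s (u i) (u (i + 1)) := fun j => by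
    induction j with
    | zero => simp
    | succ j ih =>
      rw [Finset.sum_range_succ]
      calc (norm1 (u (j + 1) - u 0) : ℕ∞)
          ≤ (norm1 (u j - u 0) + norm1 (u (j + 1) - u j) : ℕ) := by
            have := norm1_sub_le (u (j + 1)) (u j) (u 0)
            exact_mod_cast (by omega)
        _ ≤ _ := by
            rw [Nat.cast_add]
            exact add_le_add ih (norm1_sub_le_hitTime s _ _)
  rw [← h0, ← hm]
  exact key m

/-- A configuration with enough crowded sites, all of which emit particles at full speed, is
invaded at asymptotically full speed. -/
lemma exists_passageTime_le {d : ℕ} {ω : Config d} {s : PathSpace ω} {m : ℕ} (hm : 1 ≤ m)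
    (hnear : ∀ᶠ n in atTop, ∀ z : Site d, norm1 z ≤ n ^ (d + 1) →
      ∃ x, m * norm1 (x - z) ≤ n ∧ threshold d n ≤ ω x)
    (hspeed : ∀ᶠ n in atTop, ∀ x y : Site d, norm1 x ≤ n ^ (d + 2) → threshold d n ≤ ω x →
      norm1 (y - x) ≤ 4 * n → hitTime s x y ≤ norm1 (y - x))
    (hstart : ∀ᶠ n in atTop, ∃ z, norm1 z ≤ n ^ (d + 1) ∧ threshold d n ≤ ω z ∧
      ∃ t : ℕ, hitTime s 0 z ≤ t) :
    ∃ A n₀ : ℕ, ∀ n ≥ n₀, ∀ y : Site d, norm1 y ≤ 3 * n →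
      ∃ t : ℕ, passageTime s 0 y ≤ t ∧ m * t ≤ A + 9 * n + m * norm1 y := by
  -- A single scale `k` beyond which all the properties hold. The start is used only at scale `k`:
  -- its crowded site `z` is reached in a finite, otherwise uncontrolled time.
  obtain ⟨k, hk⟩ := eventually_atTop.1 (hnear.and (hspeed.and (hstart.and (eventually_ge_atTop 2))))
  have hk2 : ∀ n ≥ k, 2 ≤ n := fun n hn => (hk n hn).2.2.2
  obtain ⟨z, hz, hωz, t₀, ht₀⟩ := (hk k le_rfl).2.2.1
  have hz' : ∀ n ≥ k, norm1 z ≤ n ^ (d + 1) := fun n hn => hz.trans (Nat.pow_le_pow_left hn _)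
  have hdiv : ∀ {a n : ℕ}, m * a ≤ n → a ≤ n := fun h => (Nat.le_mul_of_pos_left _ hm).trans h
  have hself : ∀ {n : ℕ}, 2 ≤ n → ∀ j, n ≤ n ^ (j + 1) := fun h j => Nat.le_self_pow (by omega) _
  -- crowded sites near `z` are activated
  have hw : ∀ n, ∃ w : Site d, k ≤ n → m * norm1 (w - z) ≤ n ∧ threshold d n ≤ ω w := fun n => by
    by_cases hn : k ≤ n
    · obtain ⟨w, hw⟩ := (hk n hn).1 z (hz' n hn)
      exact ⟨w, fun _ => hw⟩
    · exact ⟨0, fun h => absurd h hn⟩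
  choose w hw using hw
  have hwnorm : ∀ n ≥ k, norm1 (w n) ≤ n ^ (d + 2) := fun n hn => by
    have h1 := norm1_le_add_sub (w n) z
    have h2 := hdiv (hw n hn).1
    have h3 := hself (hk2 n hn) d
    have h4 : 2 * n ^ (d + 1) ≤ n ^ (d + 2) := by
      rw [pow_succ n (d + 1), mul_comm]
      exact Nat.mul_le_mul_left _ (hk2 n hn)
    have := hz' n hn
    omega
  have hwfin : ∀ n ≥ k, ∃ t : ℕ, passageTime s 0 (w n) ≤ t := fun n hn => by
    induction n, hn using Nat.le_induction with
    | base =>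
      have h := (hk k le_rfl).2.1 z (w k)
        (hz.trans (Nat.pow_le_pow_right (by have := hk2 k le_rfl; omega) (by omega))) hωz
        (by have := hdiv (hw k le_rfl).1; omega)
      exact ⟨_, passageTime_le_of_hitTime_le ((passageTime_le_hitTime s 0 z).trans ht₀) h⟩
    | succ n hn ih =>
      obtain ⟨t, ht⟩ := ih
      -- Both sites lie near `z`, at mutual distance at most `2 n + 1 ≤ 4 n`.
      have h := (hk n hn).2.1 (w n) (w (n + 1)) (hwnorm n hn) (hw n hn).2 (by
        have h1 := norm1_sub_le (w (n + 1)) z (w n)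
        rw [norm1_sub_comm z] at h1
        have h2 := hdiv (hw n hn).1
        have h3 := hdiv (hw (n + 1) (by omega)).1
        have := hk2 n hn
        omega)
      exact ⟨_, passageTime_le_of_hitTime_le ht h⟩
  -- crowded sites near the origin are activated
  have hx : ∀ n, ∃ x : Site d, k ≤ n → m * norm1 x ≤ n ∧ threshold d n ≤ ω x := fun n => by
    by_cases hn : k ≤ n
    · obtain ⟨x, hx⟩ := (hk n hn).1 0 (by simp)
      exact ⟨x, fun _ => by simpa using hx⟩
    · exact ⟨0, fun h => absurd h hn⟩
  choose x hx using hx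
  have hxnorm : ∀ n ≥ k, norm1 (x n) ≤ n ^ (d + 2) := fun n hn =>
    (hdiv (hx n hn).1).trans (hself (hk2 n hn) _)
  -- At scales `n ≥ norm1 z` the origin is close enough to `z`: `w n` and `x n` are at distance at
  -- most `3 n`.
  obtain ⟨n₁, hn₁k, hn₁z⟩ : ∃ n₁, k ≤ n₁ ∧ norm1 z ≤ n₁ :=
    ⟨max k (norm1 z), le_max_left _ _, le_max_right _ _⟩
  have hxfin : ∀ n, ∃ t : ℕ, n₁ ≤ n → passageTime s 0 (x n) ≤ t := fun n => by
    by_cases hn : n₁ ≤ n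
    · have hnk := hn₁k.trans hn
      obtain ⟨t, ht⟩ := hwfin n hnk
      have h := (hk n hnk).2.1 (w n) (x n) (hwnorm n hnk) (hw n hnk).2 (by
        have h1 := norm1_sub_le (x n) z (w n)
        have h2 := norm1_sub_le (x n) 0 z
        rw [norm1_sub_comm z] at h1
        rw [norm1_sub_comm 0, sub_zero, sub_zero] at h2
        have h3 := hdiv (hw n hnk).1
        have h4 := hdiv (hx n hnk).1
        omega)
      exact ⟨_, fun _ => passageTime_le_of_hitTime_le ht h⟩
    · exact ⟨0, fun h => absurd h hn⟩
  choose τ hτ using hxfin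
  -- quantitative bound by halving
  let A := ∑ n ∈ Finset.range (2 * n₁ + 2), m * τ n
  have hA : ∀ n ≥ n₁, ∃ t : ℕ, passageTime s 0 (x n) ≤ t ∧ m * t ≤ A + 8 * n := fun n => by
    induction n using Nat.strong_induction_on with
    | _ n ih =>
      intro hn
      by_cases hlt : n < 2 * n₁ + 2
      · refine ⟨τ n, hτ n hn, le_trans ?_ (Nat.le_add_right _ _)⟩
        exact Finset.single_le_sum (f := fun n => m * τ n) (fun _ _ => Nat.zero_le _)
          (Finset.mem_range.2 hlt)
      -- With `h = (n + 1) / 2`, the passage from `x h` to `x n` costs at most `(h + n) / m`. The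
      -- induction closes because `8 h + h + n ≤ 8 n` at these scales.
      · have hh : n₁ ≤ (n + 1) / 2 := by omega
        obtain ⟨t, ht, hmt⟩ := ih ((n + 1) / 2) (by omega) hh
        have hhk := hn₁k.trans hh
        have h1 := norm1_sub_le (x n) 0 (x ((n + 1) / 2))
        rw [norm1_sub_comm 0, sub_zero, sub_zero] at h1
        have h2 := (hx n (hn₁k.trans hn)).1
        have h3 := (hx _ hhk).1
        have h := (hk _ hhk).2.1 (x ((n + 1) / 2)) (x n) (hxnorm _ hhk) (hx _ hhk).2 (by
          have h4 := hdiv h2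
          have h5 := hdiv h3
          omega)
        refine ⟨_, passageTime_le_of_hitTime_le ht h, ?_⟩
        have h4 := Nat.mul_le_mul_left m h1
        rw [mul_add] at h4 ⊢
        omega
  refine ⟨A, n₁, fun n hn y hy => ?_⟩
  have hnk := hn₁k.trans hn
  obtain ⟨t, ht, hmt⟩ := hA n hn
  have h1 := norm1_sub_le y 0 (x n)
  rw [norm1_sub_comm 0, sub_zero, sub_zero] at h1
  have h2 := (hx n hnk).1
  have h := (hk n hnk).2.1 (x n) y (hxnorm n hnk) (hx n hnk).2 (by
    have := hdiv h2
    omega)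
  -- The ninth `n` is the detour through `x n`, which lies within `n / m` of the origin.
  refine ⟨_, passageTime_le_of_hitTime_le ht h, ?_⟩
  have h4 := Nat.mul_le_mul_left m h1
  rw [mul_add] at h4 ⊢
  omega

/-! ### The shape -/

lemma convex_diamond (d : ℕ) : Convex ℝ (diamond d) := by
  intro x hx y hy a b ha hb hab
  change ∑ i, |a * x i + b * y i| ≤ 1
  calc ∑ i, |a * x i + b * y i| ≤ ∑ i, (a * |x i| + b * |y i|) :=
        Finset.sum_le_sum fun i _ => (abs_add_le _ _).trans_eq (by
          rw [abs_mul, abs_mul, abs_of_nonneg ha, abs_of_nonneg hb])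
    _ = a * ∑ i, |x i| + b * ∑ i, |y i| := by
        rw [Finset.sum_add_distrib, Finset.mul_sum, Finset.mul_sum]
    _ ≤ a * 1 + b * 1 := add_le_add (mul_le_mul_of_nonneg_left hx ha)
        (mul_le_mul_of_nonneg_left hy hb)
    _ = 1 := by linarith

lemma mem_smul_diamond {d : ℕ} {c : ℝ} (hc : 0 < c) {v : Fin d → ℝ} :
    v ∈ c • diamond d ↔ ∑ i, |v i| ≤ c := by
  rw [Set.mem_smul_set_iff_inv_smul_mem₀ hc.ne']
  change ∑ i, |c⁻¹ * v i| ≤ 1 ↔ _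
  simp_rw [abs_mul, abs_of_pos (inv_pos.2 hc)]
  rw [← Finset.mul_sum, inv_mul_le_iff₀ hc, mul_one]

lemma cast_norm1 {d : ℕ} (y : Site d) : (norm1 y : ℝ) = ∑ i, |(y i : ℝ)| := by
  simp [norm1, Nat.cast_natAbs]

/-- The `ℓ¹` distance between the center and any point of a unit cube is at most `d / 2`. -/
lemma sum_abs_sub_le {d : ℕ} {v : Fin d → ℝ} {y : Site d}
    (h : ∀ i, v i - (y i : ℝ) ∈ Set.Ioc (-1 / 2 : ℝ) (1 / 2)) :
    |∑ i, |v i| - norm1 y| ≤ d / 2 := by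
  rw [cast_norm1, ← Finset.sum_sub_distrib]
  calc |∑ i, (|v i| - |(y i : ℝ)|)| ≤ ∑ i, |(|v i| - |(y i : ℝ)|)| :=
        Finset.abs_sum_le_sum_abs _ _
    _ ≤ ∑ _i : Fin d, (1 / 2 : ℝ) := Finset.sum_le_sum fun i _ => by
        refine (abs_abs_sub_abs_le_abs_sub _ _).trans (abs_le.2 ⟨?_, (h i).2⟩)
        linarith [(h i).1]
    _ = d / 2 := by simp [div_eq_mul_inv]

/-- This holds for every realisation: the speed limit puts visited sites in the ball of radius `n`,
and the cubes add at most `d / 2`, which is below `ε n` for large `n`. -/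
lemma eventually_cubes_visited_subset {d : ℕ} {ω : Config d} (s : PathSpace ω) {ε : ℝ}
    (hε : 0 < ε) :
    ∀ᶠ n : ℕ in atTop, (n : ℝ)⁻¹ • cubes (visited s 0 n) ⊆ (1 + ε) • diamond d := by
  filter_upwards [eventually_ge_atTop 1, eventually_ge_atTop ⌈d / ε⌉₊] with n hn1 hn
  have hn0 : (0 : ℝ) < n := by exact_mod_cast hn1
  rintro _ ⟨v, ⟨y, hy, hv⟩, rfl⟩
  have h1 : norm1 y ≤ n := by
    have := (norm1_sub_le_passageTime s 0 y).trans hy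
    rw [sub_zero] at this
    exact_mod_cast this
  have h2 := (abs_le.1 (sum_abs_sub_le hv)).2
  have h3 : (d : ℝ) ≤ n * ε := by
    rw [← div_le_iff₀ hε]
    exact (Nat.le_ceil _).trans (by exact_mod_cast hn)
  have h4 : (norm1 y : ℝ) ≤ n := by exact_mod_cast h1
  rw [mem_smul_diamond (by linarith)]
  change ∑ i, |(n : ℝ)⁻¹ * v i| ≤ 1 + ε
  simp_rw [abs_mul, abs_of_pos (inv_pos.2 hn0)]
  rw [← Finset.mul_sum, inv_mul_le_iff₀ hn0]
  have : (0 : ℝ) ≤ d := d.cast_nonneg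
  linarith

/-- The slack `m ε n ≥ 10 n` pays for the delay `9 n`, and the remaining `n` covers `A` and the
rounding error `m d / 2`. -/
lemma eventually_subset_cubes_visited {d : ℕ} {ω : Config d} {s : PathSpace ω} {ε : ℝ}
    (hε1 : ε < 1) {m A n₀ : ℕ} (hm : 10 ≤ m * ε)
    (h : ∀ n ≥ n₀, ∀ y : Site d, norm1 y ≤ 3 * n →
      ∃ t : ℕ, passageTime s 0 y ≤ t ∧ m * t ≤ A + 9 * n + m * norm1 y) :
    ∀ᶠ n : ℕ in atTop, (1 - ε) • diamond d ⊆ (n : ℝ)⁻¹ • cubes (visited s 0 n) := by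
  have hm1 : 0 < m := by
    rcases Nat.eq_zero_or_pos m with rfl | hm'
    · norm_num at hm
    · exact hm'
  have hm0 : (0 : ℝ) < m := by exact_mod_cast hm1
  have hε : 0 < ε := pos_of_mul_pos_right (by linarith) hm0.le
  filter_upwards [eventually_ge_atTop n₀, eventually_ge_atTop 1,
    eventually_ge_atTop (A + m * d)] with n hn hn1 hnA v hv
  have hn0 : (0 : ℝ) < n := by exact_mod_cast hn1
  rw [mem_smul_diamond (by linarith)] at hv
  rw [Set.mem_smul_set_iff_inv_smul_mem₀ (inv_ne_zero hn0.ne'), inv_inv]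
  -- The centre of the cube containing `n v`; the ceiling matches cubes that are open on the left
  -- and closed on the right.
  let y : Site d := fun i => ⌈(n : ℝ) * v i - 1 / 2⌉
  have hy : ∀ i, ((n : ℝ) • v) i - (y i : ℝ) ∈ Set.Ioc (-1 / 2 : ℝ) (1 / 2) := fun i => by
    have h1 := Int.le_ceil ((n : ℝ) * v i - 1 / 2)
    have h2 := Int.ceil_lt_add_one ((n : ℝ) * v i - 1 / 2)
    change (n : ℝ) * v i - (⌈(n : ℝ) * v i - 1 / 2⌉ : ℝ) ∈ _
    constructor <;> linarith
  refine ⟨y, ?_, hy⟩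
  have h1 := (abs_le.1 (sum_abs_sub_le hy)).1
  have h2 : ∑ i, |((n : ℝ) • v) i| ≤ n * (1 - ε) := by
    simp only [Pi.smul_apply, smul_eq_mul, abs_mul, abs_of_pos hn0]
    rw [← Finset.mul_sum]
    exact mul_le_mul_of_nonneg_left hv hn0.le
  have hnA' : (A : ℝ) + m * d ≤ n := by exact_mod_cast hnA
  have hd0 : (0 : ℝ) ≤ d := d.cast_nonneg
  have hdn : (d : ℝ) ≤ n := by
    have : d ≤ n := (Nat.le_mul_of_pos_left d hm1).trans (by omega)
    exact_mod_cast this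
  have hyn : (norm1 y : ℝ) ≤ n * (1 - ε) + d / 2 := by linarith
  have hy3 : norm1 y ≤ 3 * n := by
    have : (norm1 y : ℝ) ≤ 3 * n := by nlinarith
    exact_mod_cast this
  obtain ⟨t, ht, hmt⟩ := h n hn y hy3
  refine le_trans ht ?_
  have hmt' : (m : ℝ) * t ≤ A + 9 * n + m * norm1 y := by exact_mod_cast hmt
  have h3 : (m : ℝ) * norm1 y ≤ m * (n * (1 - ε) + d / 2) :=
    mul_le_mul_of_nonneg_left hyn hm0.le
  have h4 : (10 : ℝ) * n ≤ m * ε * n := mul_le_mul_of_nonneg_right hm hn0.le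
  have h5 : (0 : ℝ) ≤ m * d := by positivity
  have h6 : (m : ℝ) * t ≤ m * n := by linarith
  exact_mod_cast le_of_mul_le_mul_left h6 hm0

/-- The walk of a single particle is a simple random walk. -/
lemma measurePreserving_eval_quenchedLaw {d : ℕ} [NeZero d] {ω : Config d} (p : Particle ω) :
    MeasurePreserving (Function.eval p) (quenchedLaw ω)
      (Measure.infinitePi fun _ : ℕ => stepLaw d) :=
  measurePreserving_eval_infinitePi (fun _ : Particle ω => Measure.infinitePi fun _ => stepLaw d) p

/-- If `P[η(x) ≥ n] ≥ (log n)^(-δ)` for large `n`, with `δ < d`, the limiting shape is the full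
diamond. -/
theorem shapeTheorem_diamond {d : ℕ} [NeZero d] {q : Measure ℕ} [IsProbabilityMeasure q] {δ : ℝ}
    (hδd : δ < d) (hq : ∀ᶠ n : ℕ in atTop, (Real.log n) ^ (-δ) ≤ q.real {m | n ≤ m}) :
    ShapeTheorem d q (diamond d) := by
  refine ⟨⟨0, by simp [diamond]⟩, convex_diamond d, ?_⟩
  -- All `m` are treated at once because `m` will depend on `ε`, while the exceptional set of
  -- configurations may not.
  have hnear : ∀ᵐ ω ∂(configLaw d q), ∀ m : ℕ, 1 ≤ m → ∀ᶠ n in atTop, ∀ z : Site d,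
      norm1 z ≤ n ^ (d + 1) → ∃ x, m * norm1 (x - z) ≤ n ∧ threshold d n ≤ ω x := by
    rw [ae_all_iff]
    intro m
    by_cases hm : 1 ≤ m
    · filter_upwards [ae_exists_crowded_near hδd hq hm] with ω hω _ using hω
    · exact Eventually.of_forall fun _ h => absurd h hm
  have hcond := (cond_absolutelyContinuous (μ := configLaw d q)
    (s := {ω : Config d | 1 ≤ ω 0})).ae_le (hnear.and (ae_ae_walk_visits_crowded hδd hq))
  have hpos : MeasurableSet {ω : Config d | 1 ≤ ω 0} :=
    measurableSet_le measurable_const (measurable_pi_apply 0)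
  filter_upwards [hcond, ae_cond_mem hpos] with ω ⟨hω, hwalk⟩ hω0 ε hε hε1
  let p : Particle ω := ⟨0, ⟨0, hω0⟩⟩
  obtain ⟨m, hm⟩ := exists_nat_ge (10 / ε)
  rw [div_le_iff₀ hε] at hm
  have hm1 : 1 ≤ m := by
    rcases Nat.eq_zero_or_pos m with rfl | hm'
    · norm_num at hm
    · exact hm'
  -- The statement about one simple random walk is pulled back to the first particle at the origin,
  -- which exists by the conditioning.
  filter_upwards [ae_hitTime_le_norm1 ω,
    (measurePreserving_eval_quenchedLaw p).quasiMeasurePreserving.ae hwalk] with s hspeed hs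
  obtain ⟨A, n₀, hA⟩ := exists_passageTime_le hm1 (hω m hm1) hspeed (by
    filter_upwards [hs] with n ⟨j, hj, hj'⟩
    exact ⟨_, hj, hj', j, hitTime_le (⟨0, hω0⟩ : Fin (ω 0)) (by rw [walk_eq]; exact zero_add _)⟩)
  exact (eventually_subset_cubes_visited hε1 hm hA).and (eventually_cubes_visited_subset s hε)

end FrogModel

theorem theorem2 (d : ℕ) [NeZero d] (q : MeasureTheory.Measure ℕ)
    [MeasureTheory.IsProbabilityMeasure q] (δ : ℝ) (hδ : 0 < δ) (hδd : δ < d)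
    (hq : ∀ᶠ n : ℕ in Filter.atTop, (Real.log n) ^ (-δ) ≤ q.real {m | n ≤ m}) :
    FrogModel.ShapeTheorem d q (FrogModel.diamond d) :=
  FrogModel.shapeTheorem_diamond hδd hq
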